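/- Let $c>0$, $c_2>0$ and $0<T<T^*$. For $t>0$ put $$f_t(x)=\mathbf 1_{\{x>0\}}\frac{ct}{\sqrt{2\pi}\,x^{3/2}}\exp\Big(-\frac{c^2t^2}{2x}\Big).$$ A stable-1/2 subordinator with activity parameter $c$ is an increasing Lévy process $\{S_t\}_{t\ge 0}$ such that $S_t$ has density $f_t$ for every $t>0$. Let $p$ be a probability density on $(0,\infty)$, and let $\{S(t,T^*)\}_{0\le t\le T^*}$ be a stable-1/2 random bridge with activity parameter $c$ and terminal density $p$; that is, $S(T^*,T^*)$ has density $p$, and for some stable-1/2 subordinator $\{S_t\}$ with activity parameter $c$ $$\mathbb Q[S(t_1,T^*)\le x_1,\dots,S(t_n,T^*)\le x_n\mid S(T^*,T^*)=z]=\mathbb Q[S_{t_1}\le x_1,\dots,S_{t_n}\le x_n\mid S_{T^*}=z]$$ for all $n\ge1$, all $0<t_1<\dots<t_n<T^*$, all $(x_1,\dots,x_n)\in\mathbb R^n$ and $p(z)\,\mathrm dz$-almost every $z$. Put $\lambda=T^*/T-1$ and $k=c_2/(c\lambda)$, and define the two paid-claims processes, for $0\le t\le T$, by $$\xi^{(1)}_{tT}=S(t,T^*),\qquad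 \xi^{(2)}_{tT}=k^2S(\lambda t+T,T^*)-k^2S(T,T^*).$$ Assume that $m_2=\mathbb E[S(T^*,T^*)^2]<\infty$, and write $m_1=\mathbb E[S(T^*,T^*)]$ and $$C_{T^*}=c\sqrt{2\pi}\int_0^\infty z^{3/2}\,e^{c^2T^{*2}/(2z)}\,\Phi\big(-cT^*z^{-1/2}\big)\,p(z)\,\mathrm dz,$$ where $\Phi$ is the standard normal distribution function. Then the integral $C_{T^*}$ converges, $\xi^{(1)}_{TT}$ and $\xi^{(2)}_{TT}$ have finite second moments and strictly positive variances, and $$\mathbb E[\xi^{(1)}_{TT}]=\tfrac{T}{T^*}m_1,\qquad \mathbb E[\xi^{(2)}_{TT}]=k^2\big(1-\tfrac{T}{T^*}\big)m_1,$$ $$\mathbb E\big[(\xi^{(1)}_{TT})^2\big]=\tfrac{T}{T^*}m_2-\tfrac{T}{T^*}(T^*-T)\,C_{T^*},$$ $$\mathbb E\big[(\xi^{(2)}_{TT})^2\big]=k^4\big(1-\tfrac{T}{T^*}\big)m_2-k^4\big(1-\tfrac{T}{T^*}\big)T\,C_{T^*},$$ $$\mathbb E\big[\xi^{(1)}_{TT}\xi^{(2)}_{TT}\big]=k^2\,\tfrac{T}{T^*}(T^*-T)\,C_{T^*}.$$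 Consequently the correlation of $\xi^{(1)}_{TT}$ and $\xi^{(2)}_{TT}$ is well defined and equals $$\frac{k^2\frac{T}{T^*}(T^*-T)C_{T^*}-k^2\frac{T}{T^*}\big(1-\frac{T}{T^*}\big)m_1^2}{\sqrt{\Big(\frac{T}{T^*}m_2-\frac{T}{T^*}(T^*-T)C_{T^*}-\big(\frac{T}{T^*}m_1\big)^2\Big)\Big(k^4\big(1-\frac{T}{T^*}\big)m_2-k^4\big(1-\frac{T}{T^*}\big)TC_{T^*}-k^4\big(1-\frac{T}{T^*}\big)^2m_1^2\Big)}}.$$ -/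

import Mathlib

open MeasureTheory ProbabilityTheory Set
open scoped NNReal ENNReal

noncomputable section

/-- The density of the stable-1/2 subordinator with activity parameter `c` at time `t`:
`f_t(x) = 1_{x > 0} * c t / (√(2π) x^{3/2}) * exp (-c² t² / (2x))`. -/
def stableHalfDensity (c t x : ℝ) : ℝ :=
  if 0 < x then
    c * t / (Real.sqrt (2 * Real.pi) * x ^ (3 / 2 : ℝ)) * Real.exp (-(c ^ 2 * t ^ 2) / (2 * x))
  else 0

/-- `S` is a stable-1/2 subordinator with activity parameter `c` under `P`: it starts from `0`, has
independent and stationary increments, the increment over `[s, t]` has density `f_{t-s}`, and almost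
every path is increasing and right-continuous (so it also has left limits). -/
structure IsStableHalfSubordinator {Ω : Type*} [MeasurableSpace Ω] (c : ℝ)
    (S : ℝ≥0 → Ω → ℝ) (P : Measure Ω) : Prop where
  measurable : ∀ t, Measurable (S t)
  zero : ∀ᵐ ω ∂P, S 0 ω = 0
  indep : HasIndepIncrements S P
  law : ∀ s t : ℝ≥0, s < t →
    P.map (fun ω => S t ω - S s ω)
      = (volume : Measure ℝ).withDensity
          (fun x => ENNReal.ofReal (stableHalfDensity c ((t : ℝ) - s) x))
  monotone : ∀ᵐ ω ∂P, Monotone (fun t => S t ω)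
  rightContinuous : ∀ᵐ ω ∂P, ∀ t, ContinuousWithinAt (fun u => S u ω) (Ici t) t

/-- The measure `ν(dz) = 1_{z > 0} p(z) dz` on the real line. -/
def priorLaw (p : ℝ → ℝ) : Measure ℝ :=
  (volume.restrict (Ioi (0 : ℝ))).withDensity (fun z => ENNReal.ofReal (p z))

/-- `ξ` (looked at on `[0, T]`) is a stable-1/2 random bridge with activity parameter `c` whose
terminal value has density `p` on `(0, ∞)`: for some stable-1/2 subordinator `S` with activity
parameter `c`, the conditional finite-dimensional laws of `ξ` given `ξ_T = z` and of `S` given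
`S_T = z` agree for almost every `z` under the terminal law. (The latter are determined up to a
Lebesgue-null set of `z > 0`, since `S_T` has a density that is positive on `(0, ∞)`; the terminal
law does not charge such sets.) -/
structure IsStableHalfRandomBridge {Ω : Type*} [MeasurableSpace Ω] (c : ℝ) (T : ℝ≥0) (p : ℝ → ℝ)
    (ξ : ℝ≥0 → Ω → ℝ) (P : Measure Ω) [IsProbabilityMeasure P] : Prop where
  measurable : ∀ t, t ≤ T → Measurable (ξ t)
  law_terminal : P.map (ξ T) = priorLaw p
  bridge : ∃ (Ω' : Type) (_ : MeasurableSpace Ω') (P' : Measure Ω') (_ : IsProbabilityMeasure P')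
    (S : ℝ≥0 → Ω' → ℝ), IsStableHalfSubordinator c S P' ∧
      ∀ (n : ℕ) (t : Fin (n + 1) → ℝ≥0) (x : Fin (n + 1) → ℝ), StrictMono t →
        (∀ i, 0 < t i ∧ t i < T) →
        ∀ᵐ z ∂(priorLaw p),
          condDistrib (fun ω i => ξ (t i) ω) (ξ T) P z (Iic x)
            = condDistrib (fun ω i => S (t i) ω) (S T) P' z (Iic x)

/-- `λ = T*/T - 1`, which is used for `0 < T < T*` only. -/
def timeRatio (T Ts : ℝ≥0) : ℝ≥0 := Ts / T - 1

/-- `k = c₂ / (c λ)`. -/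
def lossScale (c c₂ : ℝ) (T Ts : ℝ≥0) : ℝ := c₂ / (c * (timeRatio T Ts : ℝ))

/-- The first paid-claims process `ξ⁽¹⁾_{tT} = S(t, T*)`, `0 ≤ t ≤ T`. -/
def paidClaims₁ {Ω : Type*} (S : ℝ≥0 → Ω → ℝ) (t : ℝ≥0) (ω : Ω) : ℝ := S t ω

/-- The second paid-claims process `ξ⁽²⁾_{tT} = k² S(λ t + T, T*) - k² S(T, T*)`, `0 ≤ t ≤ T`. -/
def paidClaims₂ {Ω : Type*} (c c₂ : ℝ) (T Ts : ℝ≥0) (S : ℝ≥0 → Ω → ℝ) (t : ℝ≥0) (ω : Ω) : ℝ :=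
  lossScale c c₂ T Ts ^ 2 * S (timeRatio T Ts * t + T) ω - lossScale c c₂ T Ts ^ 2 * S T ω

/-- The standard normal distribution function. -/
def stdNormalCDF (x : ℝ) : ℝ := cdf (gaussianReal 0 1) x

/-- The integrand of `C_{T*}`. -/
def crossIntegrand (c Ts : ℝ) (p : ℝ → ℝ) (z : ℝ) : ℝ :=
  z ^ (3 / 2 : ℝ) * Real.exp (c ^ 2 * Ts ^ 2 / (2 * z))
    * stdNormalCDF (-(c * Ts * z ^ (-(1 / 2) : ℝ))) * p z

/-- `C_{T*} = c √(2π) ∫₀^∞ z^{3/2} exp (c² T*² / (2z)) Φ(-c T* z^{-1/2}) p(z) dz`. -/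
def crossConst (c Ts : ℝ) (p : ℝ → ℝ) : ℝ :=
  c * Real.sqrt (2 * Real.pi) * ∫ z in Ioi (0 : ℝ), crossIntegrand c Ts p z

/-- The correlation of two real random variables, in terms of their first two moments. -/
def correlation {Ω : Type*} [MeasurableSpace Ω] (X Y : Ω → ℝ) (P : Measure Ω) : ℝ :=
  ((∫ ω, X ω * Y ω ∂P) - (∫ ω, X ω ∂P) * (∫ ω, Y ω ∂P)) /
    Real.sqrt (((∫ ω, X ω ^ 2 ∂P) - (∫ ω, X ω ∂P) ^ 2) *
      ((∫ ω, Y ω ^ 2 ∂P) - (∫ ω, Y ω ∂P) ^ 2))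

end

/-!
Write `μ_t` for the law of the subordinator at time `t`. Since the bridge and the subordinator have
the same conditional laws given their terminal values, the joint law of the increments of the bridge
over `[0, T]` and `[T, T*]` has a density `ρ(x + y)` with respect to the product of `μ_T` and
`μ_{T* - T}`. Every moment is thus an integral against a convolution of size-biased laws.

Size-biasing a stable-1/2 law gives a tail of the potential measure: `x μ_t(dx) = c² t U_t(dx)` with
`U_t = ∫ₜ^∞ μ_s ds`, because `s ↦ c² f_s(x)` has the Gaussian density of variance `x / c²` as its
tail integral. By the semigroup property `U_t ∗ μ_r = U_{t+r}`, which says that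
`E[S_T | S_{T*}] = (T / T*) S_{T*}`, and `U_t ∗ U_r = ∫_{t+r}^∞ U_s ds`, whose density is a Gaussian
tail. The latter is the source of `Φ` in `C_{T*}` and gives the cross moment of the two increments.
-/

lemma lintegral_conv_withDensity {M : Type*} [AddMonoid M] [MeasurableSpace M] [MeasurableAdd₂ M]
    {μ ν : Measure M} [SFinite μ] [SFinite ν] {f g : M → ℝ≥0∞} (hf : Measurable f)
    (hg : Measurable g) {φ : M → ℝ≥0∞} (hφ : Measurable φ) :
    ∫⁻ z, φ z ∂(μ.withDensity f ∗ ν.withDensity g)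
      = ∫⁻ q, f q.1 * g q.2 * φ (q.1 + q.2) ∂μ.prod ν := by
  rw [Measure.lintegral_conv_eq_lintegral_sum hφ, prod_withDensity hf hg,
    lintegral_withDensity_eq_lintegral_mul _ (by fun_prop) (by fun_prop)]
  rfl

lemma setLIntegral_Ioi_comp_add_right (g : ℝ → ℝ≥0∞) (t r : ℝ) :
    ∫⁻ s in Ioi t, g (s + r) = ∫⁻ s in Ioi (t + r), g s := by
  rw [← (measurePreserving_add_right volume r).setLIntegral_comp_preimage_emb
    (measurableEmbedding_addRight r) g (Ioi (t + r)), preimage_add_const_Ioi, add_sub_cancel_right]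

lemma ae_eq_of_forall_measure_Iic_eq {β ι : Type*} [MeasurableSpace β] [Finite ι] {μ : Measure β}
    {κ η : Kernel β (ι → ℝ)} [IsMarkovKernel κ] [IsMarkovKernel η]
    (h : ∀ x, ∀ᵐ z ∂μ, κ z (Iic x) = η z (Iic x)) : κ =ᵐ[μ] η := by
  have hrat : ∀ᵐ z ∂μ, ∀ q : ι → ℚ, κ z (Iic fun i => (q i : ℝ)) = η z (Iic fun i => (q i : ℝ)) :=
    ae_all_iff.2 fun q => h _
  have hspan : IsCountablySpanning (⋃ a : ℚ, {Iic (a : ℝ)}) := by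
    obtain ⟨e, he⟩ := exists_surjective_nat ℚ
    refine ⟨fun n => Iic (e n : ℝ), fun n => by simp, eq_univ_of_forall fun x => ?_⟩
    obtain ⟨q, hq⟩ := exists_rat_gt x
    obtain ⟨n, rfl⟩ := he q
    exact mem_iUnion.2 ⟨n, hq.le⟩
  filter_upwards [hrat] with z hz
  refine ext_of_generate_finite _
    (generateFrom_eq_pi (fun _ => by rw [← Real.borel_eq_generateFrom_Iic_rat]; rfl)
      fun _ => hspan).symm (IsPiSystem.pi fun _ => Real.isPiSystem_Iic_rat) ?_ (by simp)
  rintro _ ⟨s, hs, rfl⟩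
  simp only [mem_pi, mem_univ, mem_iUnion, mem_singleton_iff, forall_const] at hs
  choose q hq using hs
  obtain rfl : s = fun i => Iic (q i : ℝ) := funext hq
  rw [pi_univ_Iic]
  exact hz q

lemma withDensity_compProd {α β : Type*} [MeasurableSpace α] [MeasurableSpace β] {μ : Measure α}
    [SFinite μ] {κ : Kernel α β} [IsSFiniteKernel κ] {ρ : α → ℝ≥0∞} (hρ : Measurable ρ) :
    μ.withDensity ρ ⊗ₘ κ = (μ ⊗ₘ κ).withDensity fun q => ρ q.1 := by
  refine Measure.ext_of_lintegral _ fun φ hφ => ?_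
  rw [Measure.lintegral_compProd hφ,
    lintegral_withDensity_eq_lintegral_mul _ hρ hφ.lintegral_kernel_prod_right',
    lintegral_withDensity_eq_lintegral_mul _ (by fun_prop) hφ,
    Measure.lintegral_compProd (by fun_prop)]
  refine lintegral_congr fun a => ?_
  simp only [Pi.mul_apply]
  rw [lintegral_const_mul _ (by fun_prop)]

lemma map_prodMk_eq_withDensity_of_condDistrib {Ω Ω' β γ : Type*} [MeasurableSpace Ω]
    [MeasurableSpace Ω'] [MeasurableSpace β] [MeasurableSpace γ] [StandardBorelSpace γ]
    [Nonempty γ] {P : Measure Ω} {P' : Measure Ω'} [IsFiniteMeasure P] [IsFiniteMeasure P']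
    {Z : Ω → β} {Z' : Ω' → β} {V : Ω → γ} {V' : Ω' → γ} {ρ : β → ℝ≥0∞}
    (hV : AEMeasurable V P) (hV' : AEMeasurable V' P') (hρ : Measurable ρ)
    (hZ : P.map Z = (P'.map Z').withDensity ρ)
    (h : condDistrib V Z P =ᵐ[P.map Z] condDistrib V' Z' P') :
    P.map (fun ω => (Z ω, V ω)) = (P'.map fun ω => (Z' ω, V' ω)).withDensity fun q => ρ q.1 := by
  rw [← compProd_map_condDistrib hV, Measure.compProd_congr h, hZ, withDensity_compProd hρ,
    compProd_map_condDistrib hV']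

lemma map_withDensity_comp {α β : Type*} [MeasurableSpace α] [MeasurableSpace β] {μ : Measure α}
    {f : α → β} {ρ : β → ℝ≥0∞} (hf : Measurable f) (hρ : Measurable ρ) :
    (μ.withDensity fun a => ρ (f a)).map f = (μ.map f).withDensity ρ := by
  ext s hs
  rw [Measure.map_apply hf hs, withDensity_apply _ (hf hs), withDensity_apply _ hs,
    setLIntegral_map hs hρ hf]

lemma variance_pos_of_nullSingletonClass_map {Ω : Type*} [MeasurableSpace Ω] {P : Measure Ω}
    [IsProbabilityMeasure P] {X : Ω → ℝ} (hX : MemLp X 2 P) [NullSingletonClass (P.map X)] :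
    0 < Var[X; P] := by
  refine (variance_nonneg X P).lt_of_ne fun h => ?_
  have hconst : ∀ᵐ x ∂P.map X, x = P[X] :=
    (ae_map_iff hX.aemeasurable (measurableSet_singleton _)).2
      (ae_eq_integral_of_variance_eq_zero hX h.symm)
  have := Measure.isProbabilityMeasure_map hX.aemeasurable
  obtain ⟨x, hx, hx'⟩ := (hconst.and (Measure.ae_ne (P.map X) P[X])).exists
  exact hx' hx

section Density

variable {c t x : ℝ}

lemma measurable_stableHalfDensity_uncurry (c : ℝ) :
    Measurable (Function.uncurry (stableHalfDensity c)) := by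
  unfold stableHalfDensity
  exact Measurable.ite (measurableSet_lt measurable_const measurable_snd) (by fun_prop)
    measurable_const

@[fun_prop]
lemma measurable_stableHalfDensity (c t : ℝ) : Measurable (stableHalfDensity c t) :=
  (measurable_stableHalfDensity_uncurry c).comp measurable_prodMk_left

lemma stableHalfDensity_nonneg (hc : 0 < c) (ht : 0 ≤ t) (x : ℝ) :
    0 ≤ stableHalfDensity c t x := by
  unfold stableHalfDensity
  split_ifs <;> positivity

lemma stableHalfDensity_pos (hc : 0 < c) (ht : 0 < t) (hx : 0 < x) :
    0 < stableHalfDensity c t x := by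
  rw [stableHalfDensity, if_pos hx]
  positivity

lemma coe_toNNReal_div_sq (c : ℝ) (hx : 0 < x) : ((x / c ^ 2).toNNReal : ℝ) = x / c ^ 2 :=
  Real.coe_toNNReal _ (by positivity)

lemma toNNReal_div_sq_ne_zero (hc : 0 < c) (hx : 0 < x) : (x / c ^ 2).toNNReal ≠ 0 :=
  (Real.toNNReal_pos.2 (by positivity)).ne'

lemma mul_stableHalfDensity (hc : 0 < c) (hx : 0 < x) (t : ℝ) :
    x * stableHalfDensity c t x = t * gaussianPDFReal 0 (x / c ^ 2).toNNReal t := by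
  have hpow : x ^ (3 / 2 : ℝ) = x * √x := by
    rw [show (3 / 2 : ℝ) = 1 + 1 / 2 by norm_num, Real.rpow_add hx, Real.rpow_one,
      Real.sqrt_eq_rpow]
  have hsqrt : √(2 * Real.pi * (x / c ^ 2)) = √(2 * Real.pi) * √x / c := by
    rw [← mul_div_assoc, Real.sqrt_div (by positivity), Real.sqrt_sq hc.le,
      Real.sqrt_mul (by positivity)]
  have hexp : -(t - 0) ^ 2 / (2 * (x / c ^ 2)) = -(c ^ 2 * t ^ 2) / (2 * x) := by
    field_simp
    ring
  have hx' : √x ≠ 0 := (Real.sqrt_pos.2 hx).ne'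
  rw [stableHalfDensity, if_pos hx, gaussianPDFReal, coe_toNNReal_div_sq c hx, hsqrt, hexp, hpow]
  field_simp

lemma hasDerivAt_gaussianPDFReal_zero {v : ℝ≥0} (hv : v ≠ 0) (t : ℝ) :
    HasDerivAt (gaussianPDFReal 0 v) (-(t / v * gaussianPDFReal 0 v t)) t := by
  have hexponent : HasDerivAt (fun s : ℝ => -(s - 0) ^ 2 / (2 * v)) (-(t / v)) t := by
    convert! ((((hasDerivAt_id t).sub_const 0).pow 2).neg).div_const (2 * (v : ℝ)) using 1
    simp
    field_simp
  unfold gaussianPDFReal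
  convert! hexponent.exp.const_mul (√(2 * Real.pi * v))⁻¹ using 1
  ring

lemma tendsto_gaussianPDFReal_zero_atTop {v : ℝ≥0} (hv : v ≠ 0) :
    Filter.Tendsto (gaussianPDFReal 0 v) Filter.atTop (nhds 0) := by
  unfold gaussianPDFReal
  simp only [sub_zero, neg_div]
  rw [← mul_zero (√(2 * Real.pi * v))⁻¹]
  exact .const_mul _ <| Real.tendsto_exp_neg_atTop_nhds_zero.comp
    ((Filter.tendsto_pow_atTop two_ne_zero).atTop_div_const (by positivity))

lemma setLIntegral_Ioi_stableHalfDensity (hc : 0 < c) (ht : 0 ≤ t) (hx : 0 < x) :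
    ENNReal.ofReal (c ^ 2) * ∫⁻ s in Ioi t, ENNReal.ofReal (stableHalfDensity c s x)
      = gaussianPDF 0 (x / c ^ 2).toNNReal t := by
  have hv := toNNReal_div_sq_ne_zero hc hx
  have hlim : Filter.Tendsto (fun s => -gaussianPDFReal 0 (x / c ^ 2).toNNReal s) Filter.atTop
      (nhds 0) := by simpa using (tendsto_gaussianPDFReal_zero_atTop hv).neg
  have hderiv : ∀ s ∈ Ici t, HasDerivAt (fun s => -gaussianPDFReal 0 (x / c ^ 2).toNNReal s)
      (c ^ 2 * stableHalfDensity c s x) s := fun s _ => by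
    convert! (hasDerivAt_gaussianPDFReal_zero hv s).neg using 1
    rw [coe_toNNReal_div_sq c hx, neg_neg, div_mul_eq_mul_div, eq_div_iff (by positivity)]
    field_simp
    rw [mul_comm _ x, mul_stableHalfDensity hc hx]
  have hpos : ∀ s ∈ Ioi t, 0 ≤ c ^ 2 * stableHalfDensity c s x := fun s hs =>
    mul_nonneg (sq_nonneg c) (stableHalfDensity_nonneg hc (ht.trans (mem_Ioi.1 hs).le) x)
  have hval := integral_Ioi_of_hasDerivAt_of_nonneg' hderiv hpos hlim
  rw [zero_sub, neg_neg] at hval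
  rw [gaussianPDF, ← hval, ofReal_integral_eq_lintegral_ofReal
    (integrableOn_Ioi_deriv_of_nonneg' hderiv hpos hlim) (ae_restrict_of_forall_mem
      measurableSet_Ioi hpos), ← lintegral_const_mul' _ _ ENNReal.ofReal_ne_top]
  simp_rw [ENNReal.ofReal_mul (sq_nonneg c)]

lemma gaussianReal_Ioi_eq_stdNormalCDF {w : ℝ} (hc : 0 < c) (hw : 0 < w) (t : ℝ) :
    gaussianReal 0 (w / c ^ 2).toNNReal (Ioi t)
      = ENNReal.ofReal (stdNormalCDF (-(c * t * w ^ (-(1 / 2) : ℝ)))) := by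
  have hs : 0 < √w := Real.sqrt_pos.2 hw
  have hmap : gaussianReal 0 (w / c ^ 2).toNNReal
      = (gaussianReal 0 1).map (fun x => -(√w / c) * x) := by
    rw [gaussianReal_map_const_mul, mul_zero]
    congr 1
    ext
    simp [coe_toNNReal_div_sq c hw, div_pow, Real.sq_sqrt hw.le]
  have hpre : (fun x => -(√w / c) * x) ⁻¹' Ioi t = Iio (-(c * t * w ^ (-(1 / 2) : ℝ))) := by
    ext x
    rw [Real.rpow_neg hw.le, ← Real.sqrt_eq_rpow, mem_preimage, mem_Ioi, mem_Iio, lt_neg,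
      ← div_eq_mul_inv, div_lt_iff₀ hs, neg_mul, div_mul_eq_mul_div, ← neg_div, lt_div_iff₀ hc]
    constructor <;> intro h <;> linarith
  have := nullSingletonClass_gaussianReal (μ := 0) one_ne_zero
  rw [hmap, Measure.map_apply (by fun_prop) measurableSet_Ioi, hpre, stdNormalCDF, ofReal_cdf,
    measure_congr Iio_ae_eq_Iic]

@[fun_prop]
lemma measurable_stdNormalCDF : Measurable stdNormalCDF :=
  (monotone_cdf _).measurable

lemma stdNormalCDF_nonneg (x : ℝ) : 0 ≤ stdNormalCDF x :=
  cdf_nonneg _ x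

end Density

section Law

variable {c t : ℝ}

/-- The laws of the stable-1/2 subordinator with activity parameter `c`, as a kernel in the time
variable; `stableHalfLaw c t` is the zero measure at time `t = 0`, where there is no density. -/
noncomputable def stableHalfLaw (c : ℝ) : Kernel ℝ ℝ :=
  (Kernel.const ℝ volume).withDensity fun t x => ENNReal.ofReal (stableHalfDensity c t x)

instance (c : ℝ) : IsSFiniteKernel (stableHalfLaw c) :=
  Kernel.IsSFiniteKernel.withDensity _ fun _ _ => ENNReal.ofReal_ne_top

lemma stableHalfLaw_apply (c t : ℝ) :
    stableHalfLaw c t = volume.withDensity fun x => ENNReal.ofReal (stableHalfDensity c t x) := by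
  rw [stableHalfLaw, Kernel.withDensity_apply _
    (measurable_stableHalfDensity_uncurry c).ennreal_ofReal, Kernel.const_apply]

lemma stableHalfLaw_eq_restrict (c t : ℝ) :
    stableHalfLaw c t = (volume.restrict (Ioi 0)).withDensity
      fun x => ENNReal.ofReal (stableHalfDensity c t x) := by
  rw [stableHalfLaw_apply, ← withDensity_indicator measurableSet_Ioi]
  congr with x
  by_cases hx : x ∈ Ioi 0
  · rw [indicator_of_mem hx]
  · rw [indicator_of_notMem hx, stableHalfDensity, if_neg (by simpa using hx), ENNReal.ofReal_zero]

lemma stableHalfLaw_absolutelyContinuous (c t : ℝ) :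
    stableHalfLaw c t ≪ volume.restrict (Ioi 0) := by
  rw [stableHalfLaw_eq_restrict]
  exact withDensity_absolutelyContinuous _ _

/-- The tail `∫ₜ^∞ μ_s ds` of the potential measure of the stable-1/2 subordinator, where `μ_s` is
its law at time `s`. -/
noncomputable def tailPotential (c t : ℝ) : Measure ℝ :=
  (volume.restrict (Ioi t)).bind (stableHalfLaw c)

instance (c t : ℝ) : SFinite (tailPotential c t) := by
  unfold tailPotential
  infer_instance

lemma lintegral_tailPotential (c t : ℝ) {φ : ℝ → ℝ≥0∞} (hφ : Measurable φ) :
    ∫⁻ x, φ x ∂tailPotential c t = ∫⁻ s in Ioi t, ∫⁻ x, φ x ∂stableHalfLaw c s :=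
  Measure.lintegral_bind (Kernel.aemeasurable _) hφ.aemeasurable

lemma smul_tailPotential (hc : 0 < c) (ht : 0 ≤ t) :
    ENNReal.ofReal (c ^ 2) • tailPotential c t = (volume.restrict (Ioi 0)).withDensity
      fun x => gaussianPDF 0 (x / c ^ 2).toNNReal t := by
  have hf : Measurable fun q : ℝ × ℝ => ENNReal.ofReal (stableHalfDensity c q.1 q.2) :=
    (measurable_stableHalfDensity_uncurry c).ennreal_ofReal
  refine Measure.ext_of_lintegral _ fun φ hφ => ?_
  have hlaw : ∀ s, ∫⁻ x, φ x ∂stableHalfLaw c s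
      = ∫⁻ x in Ioi 0, ENNReal.ofReal (stableHalfDensity c s x) * φ x := fun s => by
    rw [stableHalfLaw_eq_restrict]
    exact lintegral_withDensity_eq_lintegral_mul _ (by fun_prop) hφ
  rw [lintegral_smul_measure, smul_eq_mul, lintegral_tailPotential c t hφ]
  simp_rw [hlaw]
  rw [lintegral_lintegral_swap (hf.mul (hφ.comp measurable_snd)).aemeasurable,
    ← lintegral_const_mul' _ _ ENNReal.ofReal_ne_top,
    lintegral_withDensity_eq_lintegral_mul _ (by fun_prop) hφ]
  refine setLIntegral_congr_fun measurableSet_Ioi fun x hx => ?_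
  rw [lintegral_mul_const _ (by exact hf.comp measurable_prodMk_right), ← mul_assoc,
    setLIntegral_Ioi_stableHalfDensity hc ht hx, Pi.mul_apply]

lemma stableHalfLaw_withDensity_ofReal (hc : 0 < c) (ht : 0 ≤ t) :
    (stableHalfLaw c t).withDensity ENNReal.ofReal
      = ENNReal.ofReal (c ^ 2 * t) • tailPotential c t := by
  rw [mul_comm, ENNReal.ofReal_mul ht, mul_smul, smul_tailPotential hc ht,
    ← withDensity_smul _ (by fun_prop), stableHalfLaw_eq_restrict,
    ← withDensity_mul _ (by fun_prop) (by fun_prop)]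
  refine withDensity_congr_ae (ae_restrict_of_forall_mem measurableSet_Ioi fun x hx => ?_)
  simp only [Pi.mul_apply, Pi.smul_apply, smul_eq_mul, gaussianPDF]
  rw [← ENNReal.ofReal_mul (stableHalfDensity_nonneg hc ht x), ← ENNReal.ofReal_mul ht, mul_comm,
    mul_stableHalfDensity hc hx]

lemma lintegral_tailPotential_conv (c t : ℝ) (ν : Measure ℝ) [SFinite ν] {φ : ℝ → ℝ≥0∞}
    (hφ : Measurable φ) :
    ∫⁻ w, φ w ∂(tailPotential c t ∗ ν) = ∫⁻ s in Ioi t, ∫⁻ w, φ w ∂(stableHalfLaw c s ∗ ν) := by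
  simp_rw [Measure.lintegral_conv hφ]
  exact lintegral_tailPotential c t (by fun_prop)

end Law

namespace IsStableHalfSubordinator

variable {Ω : Type*} [MeasurableSpace Ω] {c : ℝ} {S : ℝ≥0 → Ω → ℝ} {P : Measure Ω}

lemma map_eq (hS : IsStableHalfSubordinator c S P) {t : ℝ≥0} (ht : 0 < t) :
    P.map (S t) = stableHalfLaw c t := by
  rw [stableHalfLaw_apply, ← sub_zero (t : ℝ), ← NNReal.coe_zero, ← hS.law 0 t ht]
  refine Measure.map_congr ?_
  filter_upwards [hS.zero] with ω hω
  rw [hω, sub_zero]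

lemma map_increments [IsProbabilityMeasure P] (hS : IsStableHalfSubordinator c S P) {t u : ℝ≥0}
    (ht : 0 < t) (htu : t < u) :
    P.map (fun ω => (S t ω, S u ω - S t ω))
      = (stableHalfLaw c t).prod (stableHalfLaw c (u - t)) := by
  have hindep := hS.indep.indepFun_eval_sub zero_le htu.le hS.zero
  rw [indepFun_iff_map_prod_eq_prod_map_map (hS.measurable t).aemeasurable
    ((hS.measurable u).sub (hS.measurable t)).aemeasurable] at hindep
  rw [← hS.map_eq ht, stableHalfLaw_apply, ← hS.law t u htu]
  exact hindep

lemma stableHalfLaw_conv [IsProbabilityMeasure P] (hS : IsStableHalfSubordinator c S P) {s r : ℝ}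
    (hs : 0 < s) (hr : 0 < r) :
    stableHalfLaw c s ∗ stableHalfLaw c r = stableHalfLaw c (s + r) := by
  lift s to ℝ≥0 using hs.le
  lift r to ℝ≥0 using hr.le
  rw [NNReal.coe_pos] at hs hr
  have hmeas := hS.measurable
  have hincr := hS.map_increments hs (lt_add_of_pos_right s hr)
  rw [NNReal.coe_add, add_sub_cancel_left] at hincr
  rw [← NNReal.coe_add, ← hS.map_eq (add_pos hs hr), Measure.conv, ← hincr,
    Measure.map_map (by fun_prop) (by fun_prop)]
  simp [Function.comp_def]

lemma tailPotential_conv_stableHalfLaw [IsProbabilityMeasure P]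
    (hS : IsStableHalfSubordinator c S P) {t r : ℝ} (ht : 0 ≤ t) (hr : 0 < r) :
    tailPotential c t ∗ stableHalfLaw c r = tailPotential c (t + r) := by
  refine Measure.ext_of_lintegral _ fun φ hφ => ?_
  rw [lintegral_tailPotential_conv c t _ hφ, lintegral_tailPotential c (t + r) hφ,
    ← setLIntegral_Ioi_comp_add_right]
  exact setLIntegral_congr_fun measurableSet_Ioi fun s (hs : t < s) => by
    rw [hS.stableHalfLaw_conv (ht.trans_lt hs) hr]

lemma tailPotential_conv_tailPotential [IsProbabilityMeasure P]
    (hS : IsStableHalfSubordinator c S P) (hc : 0 < c) {t r : ℝ} (ht : 0 ≤ t) (hr : 0 ≤ r) :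
    ENNReal.ofReal (c ^ 2) • (tailPotential c t ∗ tailPotential c r)
      = (volume.restrict (Ioi 0)).withDensity fun w =>
          ENNReal.ofReal (stdNormalCDF (-(c * (t + r) * w ^ (-(1 / 2) : ℝ)))) := by
  refine Measure.ext_of_lintegral _ fun φ hφ => ?_
  have hshift : ∫⁻ w, φ w ∂(tailPotential c t ∗ tailPotential c r)
      = ∫⁻ u in Ioi (t + r), ∫⁻ w, φ w ∂tailPotential c u := by
    rw [lintegral_tailPotential_conv c t _ hφ, ← setLIntegral_Ioi_comp_add_right]
    exact setLIntegral_congr_fun measurableSet_Ioi fun s (hs : t < s) => by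
      rw [Measure.conv_comm, hS.tailPotential_conv_stableHalfLaw hr (ht.trans_lt hs), add_comm]
  have hgauss : ∀ u ∈ Ioi (t + r), ENNReal.ofReal (c ^ 2) * ∫⁻ w, φ w ∂tailPotential c u
      = ∫⁻ w in Ioi 0, gaussianPDF 0 (w / c ^ 2).toNNReal u * φ w := fun u hu => by
    rw [← smul_eq_mul, ← lintegral_smul_measure,
      smul_tailPotential hc ((add_nonneg ht hr).trans (mem_Ioi.1 hu).le)]
    exact lintegral_withDensity_eq_lintegral_mul _ (by fun_prop) hφ
  rw [lintegral_smul_measure, smul_eq_mul, hshift, ← lintegral_const_mul' _ _ ENNReal.ofReal_ne_top,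
    setLIntegral_congr_fun measurableSet_Ioi hgauss, lintegral_lintegral_swap (by fun_prop),
    lintegral_withDensity_eq_lintegral_mul _ (by fun_prop) hφ]
  refine setLIntegral_congr_fun measurableSet_Ioi fun w hw => ?_
  rw [lintegral_mul_const _ (by fun_prop), ← gaussianReal_apply _ (toNNReal_div_sq_ne_zero hc hw),
    gaussianReal_Ioi_eq_stdNormalCDF hc hw, Pi.mul_apply]

lemma withDensity_ofReal_conv_stableHalfLaw [IsProbabilityMeasure P]
    (hS : IsStableHalfSubordinator c S P) (hc : 0 < c) {t r : ℝ} (ht : 0 < t) (hr : 0 < r) :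
    (stableHalfLaw c t).withDensity ENNReal.ofReal ∗ stableHalfLaw c r
      = ENNReal.ofReal (t / (t + r)) • (stableHalfLaw c (t + r)).withDensity ENNReal.ofReal := by
  rw [stableHalfLaw_withDensity_ofReal hc ht.le,
    stableHalfLaw_withDensity_ofReal hc (by positivity), Measure.conv_smul_left,
    hS.tailPotential_conv_stableHalfLaw ht.le hr, smul_smul,
    ← ENNReal.ofReal_mul (by positivity)]
  congr 2
  field_simp

lemma withDensity_ofReal_conv_withDensity_ofReal [IsProbabilityMeasure P]
    (hS : IsStableHalfSubordinator c S P) (hc : 0 < c) {t r : ℝ} (ht : 0 ≤ t) (hr : 0 ≤ r) :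
    (stableHalfLaw c t).withDensity ENNReal.ofReal ∗ (stableHalfLaw c r).withDensity ENNReal.ofReal
      = ENNReal.ofReal (c ^ 2 * t * r) • (volume.restrict (Ioi 0)).withDensity fun w =>
          ENNReal.ofReal (stdNormalCDF (-(c * (t + r) * w ^ (-(1 / 2) : ℝ)))) := by
  rw [stableHalfLaw_withDensity_ofReal hc ht, Measure.conv_smul_left, Measure.conv_comm,
    stableHalfLaw_withDensity_ofReal hc hr, Measure.conv_smul_left, Measure.conv_comm,
    ← hS.tailPotential_conv_tailPotential hc ht hr, smul_smul, smul_smul,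
    ← ENNReal.ofReal_mul (by positivity), ← ENNReal.ofReal_mul (by positivity)]
  congr 2
  ring

end IsStableHalfSubordinator

section BridgeDensity

variable {c t : ℝ} {p : ℝ → ℝ}

/-- The density of the terminal law `p(z) dz` of a stable-1/2 random bridge over `[0, t]` with
respect to the law of the stable-1/2 subordinator at time `t`. On `(-∞, 0]`, which is null for the
latter, it is `0` because of the division by `0`. -/
noncomputable def bridgeDensity (c t : ℝ) (p : ℝ → ℝ) (w : ℝ) : ℝ≥0∞ :=
  ENNReal.ofReal (p w / stableHalfDensity c t w)

@[fun_prop]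
lemma measurable_bridgeDensity (hp : Measurable p) : Measurable (bridgeDensity c t p) := by
  unfold bridgeDensity
  fun_prop

lemma priorLaw_eq_withDensity (hc : 0 < c) (ht : 0 < t) (hp : Measurable p) :
    priorLaw p = (stableHalfLaw c t).withDensity (bridgeDensity c t p) := by
  rw [priorLaw, stableHalfLaw_eq_restrict, ← withDensity_mul _ (by fun_prop) (by fun_prop)]
  refine withDensity_congr_ae (ae_restrict_of_forall_mem measurableSet_Ioi fun w hw => ?_)
  have hf := stableHalfDensity_pos hc ht hw
  rw [Pi.mul_apply, bridgeDensity, ← ENNReal.ofReal_mul hf.le, mul_div_cancel₀ _ hf.ne']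

lemma bridgeDensity_mul_stdNormalCDF (hc : 0 < c) (ht : 0 < t) {w : ℝ} (hw : 0 < w) :
    bridgeDensity c t p w * ENNReal.ofReal (stdNormalCDF (-(c * t * w ^ (-(1 / 2) : ℝ))))
      = ENNReal.ofReal (√(2 * Real.pi) / (c * t) * crossIntegrand c t p w) := by
  rw [bridgeDensity, ← ENNReal.ofReal_mul' (stdNormalCDF_nonneg _), crossIntegrand,
    stableHalfDensity, if_pos hw, neg_div, Real.exp_neg]
  congr 1
  field_simp

lemma measurable_crossIntegrand (c t : ℝ) (hp : Measurable p) :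
    Measurable (crossIntegrand c t p) := by
  unfold crossIntegrand
  fun_prop

lemma crossIntegrand_nonneg (c t : ℝ) (hp0 : ∀ z, 0 ≤ p z) {z : ℝ} (hz : 0 < z) :
    0 ≤ crossIntegrand c t p z := by
  have hcdf := stdNormalCDF_nonneg (-(c * t * z ^ (-(1 / 2) : ℝ)))
  have hpz := hp0 z
  unfold crossIntegrand
  positivity

end BridgeDensity

namespace IsStableHalfRandomBridge

variable {Ω : Type*} [MeasurableSpace Ω] {P : Measure Ω} [IsProbabilityMeasure P] {c : ℝ}
  {T Ts : ℝ≥0} {p : ℝ → ℝ} {S : ℝ≥0 → Ω → ℝ}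

lemma map_increments (hS : IsStableHalfRandomBridge c Ts p S P) (hc : 0 < c) (hT : 0 < T)
    (hTs : T < Ts) (hp : Measurable p) :
    P.map (fun ω => (S T ω, S Ts ω - S T ω))
      = ((stableHalfLaw c T).prod (stableHalfLaw c (Ts - T))).withDensity
          fun q => bridgeDensity c Ts p (q.1 + q.2) := by
  obtain ⟨Ω', _, P', _, S', hS', hbridge⟩ := hS.bridge
  have hmeasT := hS.measurable T hTs.le
  have hmeasTs := hS.measurable Ts le_rfl
  have hmeas' := hS'.measurable
  have hTs0 : 0 < Ts := hT.trans hTs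
  have hdens : P.map (S Ts) = (P'.map (S' Ts)).withDensity (bridgeDensity c Ts p) := by
    rw [hS.law_terminal, hS'.map_eq hTs0,
      priorLaw_eq_withDensity hc (NNReal.coe_pos.2 hTs0) hp]
  have hcond : condDistrib (fun ω (_ : Fin 1) => S T ω) (S Ts) P
      =ᵐ[P.map (S Ts)] condDistrib (fun ω (_ : Fin 1) => S' T ω) (S' Ts) P' :=
    ae_eq_of_forall_measure_Iic_eq fun x => by
      rw [hS.law_terminal]
      exact hbridge 0 (fun _ => T) x (fun i j hij => by omega) fun _ => ⟨hT, hTs⟩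
  have hjoint : P.map (fun ω => (S Ts ω, fun _ : Fin 1 => S T ω))
      = (P'.map fun ω => (S' Ts ω, fun _ : Fin 1 => S' T ω)).withDensity
          fun q => bridgeDensity c Ts p q.1 :=
    map_prodMk_eq_withDensity_of_condDistrib (by fun_prop) (by fun_prop) (by fun_prop) hdens hcond
  let e : ℝ × (Fin 1 → ℝ) → ℝ × ℝ := fun q => (q.2 0, q.1 - q.2 0)
  have he : Measurable e := by fun_prop
  have hpair : Measurable fun ω => (S Ts ω, fun _ : Fin 1 => S T ω) := by fun_prop
  have hpair' : Measurable fun ω => (S' Ts ω, fun _ : Fin 1 => S' T ω) := by fun_prop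
  have hρ : Measurable fun q : ℝ × ℝ => bridgeDensity c Ts p (q.1 + q.2) := by fun_prop
  have hρe : (fun q => bridgeDensity c Ts p q.1)
      = fun q => bridgeDensity c Ts p ((e q).1 + (e q).2) :=
    funext fun q => by simp only [e, add_sub_cancel]
  have hmap : (P.map fun ω => (S Ts ω, fun _ : Fin 1 => S T ω)).map e
      = P.map fun ω => (S T ω, S Ts ω - S T ω) := Measure.map_map he hpair
  have hmap' : (P'.map fun ω => (S' Ts ω, fun _ : Fin 1 => S' T ω)).map e
      = P'.map fun ω => (S' T ω, S' Ts ω - S' T ω) := Measure.map_map he hpair'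
  rw [← hmap, hjoint, hρe, map_withDensity_comp (f := e) he hρ, hmap', hS'.map_increments hT hTs]

lemma lintegral_increments (hS : IsStableHalfRandomBridge c Ts p S P) (hc : 0 < c) (hT : 0 < T)
    (hTs : T < Ts) (hp : Measurable p) {f g φ : ℝ → ℝ≥0∞} (hf : Measurable f) (hg : Measurable g)
    (hφ : Measurable φ) :
    ∫⁻ ω, f (S T ω) * g (S Ts ω - S T ω) * φ (S Ts ω) ∂P
      = ∫⁻ w, bridgeDensity c Ts p w * φ w
          ∂((stableHalfLaw c T).withDensity f ∗ (stableHalfLaw c (Ts - T)).withDensity g) := by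
  have hmeasT := hS.measurable T hTs.le
  have hmeasTs := hS.measurable Ts le_rfl
  have hmap : ∫⁻ ω, f (S T ω) * g (S Ts ω - S T ω) * φ (S Ts ω) ∂P
      = ∫⁻ q, f q.1 * g q.2 * φ (q.1 + q.2) ∂P.map (fun ω => (S T ω, S Ts ω - S T ω)) := by
    rw [lintegral_map (by fun_prop) (by fun_prop)]
    simp only [add_sub_cancel]
  rw [hmap, hS.map_increments hc hT hTs hp, lintegral_conv_withDensity hf hg (by fun_prop),
    lintegral_withDensity_eq_lintegral_mul _ (by fun_prop) (by fun_prop)]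
  simp only [Pi.mul_apply]
  exact lintegral_congr fun q => mul_left_comm _ _ _

lemma lintegral_terminal (hS : IsStableHalfRandomBridge c Ts p S P) (hc : 0 < c) (hTs : 0 < Ts)
    (hp : Measurable p) {φ : ℝ → ℝ≥0∞} (hφ : Measurable φ) :
    ∫⁻ ω, φ (S Ts ω) ∂P = ∫⁻ w, bridgeDensity c Ts p w * φ w ∂stableHalfLaw c Ts := by
  rw [← lintegral_map hφ (hS.measurable Ts le_rfl), hS.law_terminal,
    priorLaw_eq_withDensity hc (by exact_mod_cast hTs) hp]
  exact lintegral_withDensity_eq_lintegral_mul _ (by fun_prop) hφ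

lemma lintegral_apply_mul_terminal (hS : IsStableHalfRandomBridge c Ts p S P) (hc : 0 < c)
    (hT : 0 < T) (hTs : T < Ts) (hp : Measurable p) {φ : ℝ → ℝ≥0∞} (hφ : Measurable φ) :
    ∫⁻ ω, ENNReal.ofReal (S T ω) * φ (S Ts ω) ∂P
      = ENNReal.ofReal (T / Ts) * ∫⁻ ω, ENNReal.ofReal (S Ts ω) * φ (S Ts ω) ∂P := by
  obtain ⟨Ω', _, P', _, S', hS', -⟩ := hS.bridge
  have hconv := hS'.withDensity_ofReal_conv_stableHalfLaw hc (NNReal.coe_pos.2 hT)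
    (sub_pos.2 (NNReal.coe_lt_coe.2 hTs))
  rw [add_sub_cancel] at hconv
  have hincr := hS.lintegral_increments hc hT hTs hp ENNReal.measurable_ofReal measurable_one hφ
  simp only [Pi.one_apply, mul_one, withDensity_one] at hincr
  rw [hincr, hconv, lintegral_smul_measure, smul_eq_mul,
    hS.lintegral_terminal hc (hT.trans hTs) hp (φ := fun w => ENNReal.ofReal w * φ w) (by fun_prop),
    lintegral_withDensity_eq_lintegral_mul _ ENNReal.measurable_ofReal (by fun_prop)]
  simp only [Pi.mul_apply, mul_left_comm]

lemma lintegral_apply_mul_increment (hS : IsStableHalfRandomBridge c Ts p S P) (hc : 0 < c)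
    (hT : 0 < T) (hTs : T < Ts) (hp : Measurable p) :
    ∫⁻ ω, ENNReal.ofReal (S T ω) * ENNReal.ofReal (S Ts ω - S T ω) ∂P
      = ∫⁻ w in Ioi 0, ENNReal.ofReal
          (T / Ts * (Ts - T) * (c * √(2 * Real.pi)) * crossIntegrand c Ts p w) := by
  obtain ⟨Ω', _, P', _, S', hS', -⟩ := hS.bridge
  have hT' : (0 : ℝ) < T := NNReal.coe_pos.2 hT
  have hTs' : (0 : ℝ) < Ts - T := sub_pos.2 (NNReal.coe_lt_coe.2 hTs)
  have hconv := hS'.withDensity_ofReal_conv_withDensity_ofReal hc hT'.le hTs'.le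
  rw [add_sub_cancel] at hconv
  have hincr := hS.lintegral_increments hc hT hTs hp ENNReal.measurable_ofReal
    ENNReal.measurable_ofReal measurable_one
  simp only [Pi.one_apply, mul_one] at hincr
  rw [hincr, hconv, lintegral_smul_measure, smul_eq_mul,
    lintegral_withDensity_eq_lintegral_mul _ (by fun_prop) (by fun_prop),
    ← lintegral_const_mul' _ _ ENNReal.ofReal_ne_top]
  refine setLIntegral_congr_fun measurableSet_Ioi fun w hw => ?_
  rw [Pi.mul_apply, mul_comm (ENNReal.ofReal (stdNormalCDF _)),
    bridgeDensity_mul_stdNormalCDF hc (hT'.trans (sub_pos.1 hTs')) hw,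
    ← ENNReal.ofReal_mul (by positivity)]
  congr 1
  have := (hT'.trans (sub_pos.1 hTs')).ne'
  field_simp

lemma absolutelyContinuous_map_apply (hS : IsStableHalfRandomBridge c Ts p S P) (hc : 0 < c)
    (hT : 0 < T) (hTs : T < Ts) (hp : Measurable p) :
    P.map (S T) ≪ volume.restrict (Ioi 0) := by
  have hmeasT := hS.measurable T hTs.le
  have hmeasTs := hS.measurable Ts le_rfl
  have hfst : P.map (S T) = (P.map fun ω => (S T ω, S Ts ω - S T ω)).map Prod.fst :=
    (Measure.map_map measurable_fst (hmeasT.prodMk (hmeasTs.sub hmeasT))).symm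
  rw [hfst, hS.map_increments hc hT hTs hp]
  exact ((withDensity_absolutelyContinuous _ _).map measurable_fst).trans
    (Measure.quasiMeasurePreserving_fst.absolutelyContinuous.trans
      (stableHalfLaw_absolutelyContinuous c T))

lemma absolutelyContinuous_map_increment (hS : IsStableHalfRandomBridge c Ts p S P) (hc : 0 < c)
    (hT : 0 < T) (hTs : T < Ts) (hp : Measurable p) :
    P.map (fun ω => S Ts ω - S T ω) ≪ volume.restrict (Ioi 0) := by
  have hmeasT := hS.measurable T hTs.le
  have hmeasTs := hS.measurable Ts le_rfl
  have hsnd : P.map (fun ω => S Ts ω - S T ω)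
      = (P.map fun ω => (S T ω, S Ts ω - S T ω)).map Prod.snd :=
    (Measure.map_map measurable_snd (hmeasT.prodMk (hmeasTs.sub hmeasT))).symm
  rw [hsnd, hS.map_increments hc hT hTs hp]
  exact ((withDensity_absolutelyContinuous _ _).map measurable_snd).trans
    (Measure.quasiMeasurePreserving_snd.absolutelyContinuous.trans
      (stableHalfLaw_absolutelyContinuous c (Ts - T)))

lemma ae_pos_and_lt (hS : IsStableHalfRandomBridge c Ts p S P) (hc : 0 < c) (hT : 0 < T)
    (hTs : T < Ts) (hp : Measurable p) : ∀ᵐ ω ∂P, 0 < S T ω ∧ S T ω < S Ts ω := by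
  have hmeasT := hS.measurable T hTs.le
  have hmeasTs := hS.measurable Ts le_rfl
  have hIoi : ∀ᵐ x ∂volume.restrict (Ioi (0 : ℝ)), 0 < x := ae_restrict_mem measurableSet_Ioi
  filter_upwards [ae_of_ae_map (by fun_prop)
      (hS.absolutelyContinuous_map_apply hc hT hTs hp |>.ae_le hIoi),
    ae_of_ae_map (by fun_prop) (hS.absolutelyContinuous_map_increment hc hT hTs hp |>.ae_le hIoi)]
    with ω happly hincr
  exact ⟨happly, sub_pos.1 hincr⟩

lemma integral_apply_mul_terminal (hS : IsStableHalfRandomBridge c Ts p S P) (hc : 0 < c)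
    (hT : 0 < T) (hTs : T < Ts) (hp : Measurable p) {φ : ℝ → ℝ} (hφ : Measurable φ)
    (hφ0 : ∀ x, 0 < x → 0 ≤ φ x) :
    ∫ ω, S T ω * φ (S Ts ω) ∂P = T / Ts * ∫ ω, S Ts ω * φ (S Ts ω) ∂P := by
  have hmeasT := hS.measurable T hTs.le
  have hmeasTs := hS.measurable Ts le_rfl
  have hae := hS.ae_pos_and_lt hc hT hTs hp
  have hlintegral := hS.lintegral_apply_mul_terminal hc hT hTs hp hφ.ennreal_ofReal
  have hleft : ∫⁻ ω, ENNReal.ofReal (S T ω * φ (S Ts ω)) ∂P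
      = ∫⁻ ω, ENNReal.ofReal (S T ω) * ENNReal.ofReal (φ (S Ts ω)) ∂P :=
    lintegral_congr_ae <| hae.mono fun ω hω => ENNReal.ofReal_mul hω.1.le
  have hright : ∫⁻ ω, ENNReal.ofReal (S Ts ω * φ (S Ts ω)) ∂P
      = ∫⁻ ω, ENNReal.ofReal (S Ts ω) * ENNReal.ofReal (φ (S Ts ω)) ∂P :=
    lintegral_congr_ae <| hae.mono fun ω hω => ENNReal.ofReal_mul (hω.1.trans hω.2).le
  rw [integral_eq_lintegral_of_nonneg_ae
      (hae.mono fun ω hω => mul_nonneg hω.1.le (hφ0 _ (hω.1.trans hω.2))) (by fun_prop),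
    integral_eq_lintegral_of_nonneg_ae (hae.mono fun ω hω =>
      mul_nonneg (hω.1.trans hω.2).le (hφ0 _ (hω.1.trans hω.2))) (by fun_prop),
    hleft, hright, hlintegral, ENNReal.toReal_mul, ENNReal.toReal_ofReal (by positivity)]

lemma integral_apply (hS : IsStableHalfRandomBridge c Ts p S P) (hc : 0 < c) (hT : 0 < T)
    (hTs : T < Ts) (hp : Measurable p) : ∫ ω, S T ω ∂P = T / Ts * ∫ ω, S Ts ω ∂P := by
  simpa using hS.integral_apply_mul_terminal hc hT hTs hp measurable_one fun _ _ => zero_le_one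

lemma memLp_apply (hS : IsStableHalfRandomBridge c Ts p S P) (hc : 0 < c) (hT : 0 < T)
    (hTs : T < Ts) (hp : Measurable p) {q : ℝ≥0∞} (hSTs : MemLp (S Ts) q P) :
    MemLp (S T) q P := by
  refine hSTs.mono (hS.measurable T hTs.le).aestronglyMeasurable ?_
  filter_upwards [hS.ae_pos_and_lt hc hT hTs hp] with ω ⟨hpos, hlt⟩
  exact abs_le_abs_of_nonneg hpos.le hlt.le

lemma memLp_increment (hS : IsStableHalfRandomBridge c Ts p S P) (hc : 0 < c) (hT : 0 < T)
    (hTs : T < Ts) (hp : Measurable p) {q : ℝ≥0∞} (hSTs : MemLp (S Ts) q P) :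
    MemLp (fun ω => S Ts ω - S T ω) q P :=
  hSTs.sub (hS.memLp_apply hc hT hTs hp hSTs)

lemma integrable_apply_mul_increment (hS : IsStableHalfRandomBridge c Ts p S P) (hc : 0 < c)
    (hT : 0 < T) (hTs : T < Ts) (hp : Measurable p) (hSTs : MemLp (S Ts) 2 P) :
    Integrable (fun ω => S T ω * (S Ts ω - S T ω)) P :=
  (hS.memLp_apply hc hT hTs hp hSTs).integrable_mul (hS.memLp_increment hc hT hTs hp hSTs)

lemma integral_increment (hS : IsStableHalfRandomBridge c Ts p S P) (hc : 0 < c) (hT : 0 < T)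
    (hTs : T < Ts) (hp : Measurable p) (hSTs : Integrable (S Ts) P) :
    ∫ ω, S Ts ω - S T ω ∂P = (1 - T / Ts) * ∫ ω, S Ts ω ∂P := by
  have hST := memLp_one_iff_integrable.1
    (hS.memLp_apply hc hT hTs hp (memLp_one_iff_integrable.2 hSTs))
  rw [integral_sub hSTs hST, hS.integral_apply hc hT hTs hp, one_sub_mul]

lemma lintegral_ofReal_apply_mul_increment (hS : IsStableHalfRandomBridge c Ts p S P) (hc : 0 < c)
    (hT : 0 < T) (hTs : T < Ts) (hp : Measurable p) :
    ∫⁻ ω, ENNReal.ofReal (S T ω * (S Ts ω - S T ω)) ∂P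
      = ∫⁻ w in Ioi 0, ENNReal.ofReal
          (T / Ts * (Ts - T) * (c * √(2 * Real.pi)) * crossIntegrand c Ts p w) := by
  rw [← hS.lintegral_apply_mul_increment hc hT hTs hp]
  exact lintegral_congr_ae <| (hS.ae_pos_and_lt hc hT hTs hp).mono fun ω hω =>
    ENNReal.ofReal_mul hω.1.le

lemma integral_apply_mul_increment (hS : IsStableHalfRandomBridge c Ts p S P) (hc : 0 < c)
    (hT : 0 < T) (hTs : T < Ts) (hp : Measurable p) (hp0 : ∀ z, 0 ≤ p z) :
    ∫ ω, S T ω * (S Ts ω - S T ω) ∂P = T / Ts * (Ts - T) * crossConst c Ts p := by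
  have hmeasT := hS.measurable T hTs.le
  have hmeasTs := hS.measurable Ts le_rfl
  have hmeas := measurable_crossIntegrand c Ts hp
  have hTs' : (0 : ℝ) < Ts - T := sub_pos.2 (NNReal.coe_lt_coe.2 hTs)
  rw [integral_eq_lintegral_of_nonneg_ae ((hS.ae_pos_and_lt hc hT hTs hp).mono fun ω hω =>
      mul_nonneg hω.1.le (sub_pos.2 hω.2).le) (by fun_prop),
    hS.lintegral_ofReal_apply_mul_increment hc hT hTs hp, ← integral_eq_lintegral_of_nonneg_ae
      (ae_restrict_of_forall_mem measurableSet_Ioi fun w hw =>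
        mul_nonneg (by positivity) (crossIntegrand_nonneg c Ts hp0 hw)) (by fun_prop),
    integral_const_mul, mul_assoc, crossConst]

lemma integrableOn_crossIntegrand (hS : IsStableHalfRandomBridge c Ts p S P) (hc : 0 < c)
    (hT : 0 < T) (hTs : T < Ts) (hp : Measurable p) (hp0 : ∀ z, 0 ≤ p z)
    (hSTs : MemLp (S Ts) 2 P) : IntegrableOn (crossIntegrand c Ts p) (Ioi 0) := by
  have hK : 0 < T / Ts * (Ts - T) * (c * √(2 * Real.pi)) := by
    have hT' : (0 : ℝ) < T := NNReal.coe_pos.2 hT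
    have hTs' : (0 : ℝ) < Ts - T := sub_pos.2 (NNReal.coe_lt_coe.2 hTs)
    have : (0 : ℝ) < Ts := hT'.trans (sub_pos.1 hTs')
    positivity
  refine (integrable_const_mul_iff (IsUnit.mk0 _ hK.ne') _).1 <|
    (lintegral_ofReal_ne_top_iff_integrable
      ((measurable_crossIntegrand c Ts hp).const_mul _).aestronglyMeasurable
      (ae_restrict_of_forall_mem measurableSet_Ioi fun w hw =>
        mul_nonneg hK.le (crossIntegrand_nonneg c Ts hp0 hw))).1 ?_
  rw [← hS.lintegral_ofReal_apply_mul_increment hc hT hTs hp]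
  exact (hS.integrable_apply_mul_increment hc hT hTs hp hSTs).lintegral_lt_top.ne

lemma integral_apply_sq (hS : IsStableHalfRandomBridge c Ts p S P) (hc : 0 < c) (hT : 0 < T)
    (hTs : T < Ts) (hp : Measurable p) (hp0 : ∀ z, 0 ≤ p z) (hSTs : MemLp (S Ts) 2 P) :
    ∫ ω, S T ω ^ 2 ∂P
      = T / Ts * ∫ ω, S Ts ω ^ 2 ∂P - T / Ts * (Ts - T) * crossConst c Ts p := by
  have hprod : Integrable (fun ω => S T ω * S Ts ω) P :=
    (hS.memLp_apply hc hT hTs hp hSTs).integrable_mul hSTs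
  have hterm := hS.integral_apply_mul_terminal hc hT hTs hp measurable_id fun _ hx => hx.le
  simp only [id_eq, ← sq] at hterm
  rw [← hterm, ← hS.integral_apply_mul_increment hc hT hTs hp hp0, ← integral_sub
    hprod (hS.integrable_apply_mul_increment hc hT hTs hp hSTs)]
  congr with ω
  ring

lemma integral_increment_sq (hS : IsStableHalfRandomBridge c Ts p S P) (hc : 0 < c) (hT : 0 < T)
    (hTs : T < Ts) (hp : Measurable p) (hp0 : ∀ z, 0 ≤ p z) (hSTs : MemLp (S Ts) 2 P) :
    ∫ ω, (S Ts ω - S T ω) ^ 2 ∂P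
      = (1 - T / Ts) * ∫ ω, S Ts ω ^ 2 ∂P - (1 - T / Ts) * T * crossConst c Ts p := by
  have hST := hS.memLp_apply hc hT hTs hp hSTs
  have hexpand : ∫ ω, (S Ts ω - S T ω) ^ 2 ∂P
      = ∫ ω, S Ts ω ^ 2 ∂P - ∫ ω, S T ω ^ 2 ∂P - 2 * ∫ ω, S T ω * (S Ts ω - S T ω) ∂P := by
    have hprod := hS.integrable_apply_mul_increment hc hT hTs hp hSTs
    rw [← integral_const_mul, ← integral_sub hSTs.integrable_sq hST.integrable_sq,
      ← integral_sub (by exact hSTs.integrable_sq.sub hST.integrable_sq) (hprod.const_mul 2)]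
    congr with ω
    ring
  have hTs0 : (Ts : ℝ) ≠ 0 := NNReal.coe_ne_zero.2 (hT.trans hTs).ne'
  rw [hexpand, hS.integral_apply_sq hc hT hTs hp hp0 hSTs,
    hS.integral_apply_mul_increment hc hT hTs hp hp0]
  field_simp
  ring

lemma variance_apply_pos (hS : IsStableHalfRandomBridge c Ts p S P) (hc : 0 < c) (hT : 0 < T)
    (hTs : T < Ts) (hp : Measurable p) (hSTs : MemLp (S Ts) 2 P) : 0 < Var[S T; P] := by
  have : NullSingletonClass (P.map (S T)) :=
    ⟨fun x => hS.absolutelyContinuous_map_apply hc hT hTs hp (measure_singleton x)⟩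
  exact variance_pos_of_nullSingletonClass_map (hS.memLp_apply hc hT hTs hp hSTs)

lemma variance_increment_pos (hS : IsStableHalfRandomBridge c Ts p S P) (hc : 0 < c) (hT : 0 < T)
    (hTs : T < Ts) (hp : Measurable p) (hSTs : MemLp (S Ts) 2 P) :
    0 < Var[fun ω => S Ts ω - S T ω; P] := by
  have : NullSingletonClass (P.map fun ω => S Ts ω - S T ω) :=
    ⟨fun x => hS.absolutelyContinuous_map_increment hc hT hTs hp (measure_singleton x)⟩
  exact variance_pos_of_nullSingletonClass_map (hS.memLp_increment hc hT hTs hp hSTs)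

end IsStableHalfRandomBridge

section PaidClaims

variable {c c₂ : ℝ} {T Ts : ℝ≥0}

lemma timeRatio_mul_add (hT : 0 < T) (hTs : T < Ts) : timeRatio T Ts * T + T = Ts := by
  rw [timeRatio, ← add_one_mul, tsub_add_cancel_of_le ((one_le_div hT).2 hTs.le),
    div_mul_cancel₀ _ hT.ne']

lemma lossScale_pos (hc : 0 < c) (hc₂ : 0 < c₂) (hT : 0 < T) (hTs : T < Ts) :
    0 < lossScale c c₂ T Ts := by
  have : (0 : ℝ) < timeRatio T Ts := NNReal.coe_pos.2 (tsub_pos_of_lt ((one_lt_div hT).2 hTs))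
  unfold lossScale
  positivity

lemma paidClaims₂_terminal {Ω : Type*} (hT : 0 < T) (hTs : T < Ts) (S : ℝ≥0 → Ω → ℝ) :
    paidClaims₂ c c₂ T Ts S T = fun ω => lossScale c c₂ T Ts ^ 2 * (S Ts ω - S T ω) := by
  ext ω
  rw [paidClaims₂, timeRatio_mul_add hT hTs, mul_sub]

end PaidClaims

theorem mainTheorem8 {Ω : Type*} [MeasurableSpace Ω] (P : Measure Ω) [IsProbabilityMeasure P]
    (c c₂ : ℝ) (hc : 0 < c) (hc₂ : 0 < c₂) (T Ts : ℝ≥0) (hT : 0 < T) (hTs : T < Ts)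
    (p : ℝ → ℝ) (hp : Measurable p) (hp0 : ∀ z, 0 ≤ p z)
    (S : ℝ≥0 → Ω → ℝ) (hS : IsStableHalfRandomBridge c Ts p S P)
    (hS2 : Integrable (fun ω => S Ts ω ^ 2) P)
    (k C m₁ m₂ : ℝ) (hk : k = lossScale c c₂ T Ts) (hC : C = crossConst c Ts p)
    (hm₁ : m₁ = ∫ ω, S Ts ω ∂P) (hm₂ : m₂ = ∫ ω, S Ts ω ^ 2 ∂P)
    (X₁ X₂ : Ω → ℝ) (hX₁ : X₁ = paidClaims₁ S T) (hX₂ : X₂ = paidClaims₂ c c₂ T Ts S T) :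
    -- all the integrals below converge
    IntegrableOn (crossIntegrand c Ts p) (Ioi 0) ∧
    Integrable (S Ts) P ∧ Integrable X₁ P ∧ Integrable X₂ P ∧
    Integrable (fun ω => X₁ ω ^ 2) P ∧ Integrable (fun ω => X₂ ω ^ 2) P ∧
    Integrable (fun ω => X₁ ω * X₂ ω) P ∧
    -- means
    (∫ ω, X₁ ω ∂P) = (T : ℝ) / Ts * m₁ ∧
    (∫ ω, X₂ ω ∂P) = k ^ 2 * (1 - (T : ℝ) / Ts) * m₁ ∧
    -- second moments
    (∫ ω, X₁ ω ^ 2 ∂P) = (T : ℝ) / Ts * m₂ - (T : ℝ) / Ts * ((Ts : ℝ) - T) * C ∧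
    (∫ ω, X₂ ω ^ 2 ∂P)
      = k ^ 4 * (1 - (T : ℝ) / Ts) * m₂ - k ^ 4 * (1 - (T : ℝ) / Ts) * T * C ∧
    -- cross moment
    (∫ ω, X₁ ω * X₂ ω ∂P) = k ^ 2 * ((T : ℝ) / Ts) * ((Ts : ℝ) - T) * C ∧
    -- the correlation is well defined, and its value
    0 < (∫ ω, X₁ ω ^ 2 ∂P) - (∫ ω, X₁ ω ∂P) ^ 2 ∧
    0 < (∫ ω, X₂ ω ^ 2 ∂P) - (∫ ω, X₂ ω ∂P) ^ 2 ∧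
    correlation X₁ X₂ P =
      (k ^ 2 * ((T : ℝ) / Ts) * ((Ts : ℝ) - T) * C
          - ((T : ℝ) / Ts * m₁) * (k ^ 2 * (1 - (T : ℝ) / Ts) * m₁)) /
        Real.sqrt
          (((T : ℝ) / Ts * m₂ - (T : ℝ) / Ts * ((Ts : ℝ) - T) * C
              - ((T : ℝ) / Ts * m₁) ^ 2) *
            (k ^ 4 * (1 - (T : ℝ) / Ts) * m₂ - k ^ 4 * (1 - (T : ℝ) / Ts) * T * C
              - (k ^ 2 * (1 - (T : ℝ) / Ts) * m₁) ^ 2)) := by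
  obtain rfl : X₁ = S T := hX₁
  rw [paidClaims₂_terminal hT hTs, ← hk] at hX₂
  subst hX₂ hC hm₁ hm₂
  have hk0 : 0 < k := hk ▸ lossScale_pos hc hc₂ hT hTs
  have hL : MemLp (S Ts) 2 P :=
    (memLp_two_iff_integrable_sq (hS.measurable Ts le_rfl).aestronglyMeasurable).2 hS2
  have hL₁ := hS.memLp_apply hc hT hTs hp hL
  have hL₂ := (hS.memLp_increment hc hT hTs hp hL).const_mul (k ^ 2)
  have hmean₁ := hS.integral_apply hc hT hTs hp
  have hmean₂ := hS.integral_increment hc hT hTs hp (hL.integrable one_le_two)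
  have hsq₁ := hS.integral_apply_sq hc hT hTs hp hp0 hL
  have hsq₂ := hS.integral_increment_sq hc hT hTs hp hp0 hL
  have hcross := hS.integral_apply_mul_increment hc hT hTs hp hp0
  have hvar₁ := hS.variance_apply_pos hc hT hTs hp hL
  have hvar₂ : 0 < Var[fun ω => k ^ 2 * (S Ts ω - S T ω); P] := by
    rw [variance_const_mul]
    exact mul_pos (by positivity) (hS.variance_increment_pos hc hT hTs hp hL)
  refine ⟨hS.integrableOn_crossIntegrand hc hT hTs hp hp0 hL, hL.integrable one_le_two,
    hL₁.integrable one_le_two, hL₂.integrable one_le_two, hL₁.integrable_sq, hL₂.integrable_sq,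
    hL₁.integrable_mul hL₂, hmean₁, ?_, hsq₁, ?_, ?_, hvar₁.trans_eq (variance_eq_sub hL₁),
    hvar₂.trans_eq (variance_eq_sub hL₂), ?_⟩
  all_goals
    simp only [correlation, mul_pow, mul_left_comm _ (k ^ 2), integral_const_mul, hmean₁, hmean₂,
      hsq₁, hsq₂, hcross]
    ring_nf
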